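/- Let $G$ be a locally compact Hausdorff topological group. A \emph{$G$-space} is a Hausdorff space with a continuous left $G$-action; $G$-maps are continuous equivariant maps, and two $G$-maps $f_0,f_1\colon X\to Y$ are \emph{$G$-homotopic} if they are joined by a homotopy $X\times[0,1]\to Y$ that is equivariant for the trivial action on $[0,1]$. A \emph{family} $\mathcal F$ of subgroups of $G$ is a set of closed subgroups that is closed under conjugation and under intersections of finitely many (at least one) members. A $G$-space $X$ is \emph{$\mathcal F$-numerable} if it has an open covering $\{U_i\}_{i\in I}$ by $G$-subspaces, such that for each $i$ there is a $G$-map $U_i\to G/G_i$ for some $G_i\in\mathcal F$, together with a locally finite partition of unity $\{e_i\}_{i\in I}$ subordinate to $\{U_i\}$ consisting of $G$-invariant functions $e_i\colon X\to[0,1]$. A \emph{model for the classifying numerable $G$-space} $J_{\mathcal F}(G)$ is an $\mathcal F$-numerable $G$-space $J$ such that every $\mathcal F$-numerable $G$-space $Y$ admits, up to $G$-homotopy, precisely one $G$-map $Y\to J$. The \emph{infinite join} $\ast_{n=1}^{\infty}Z$ of a $G$-space $Z$ is the set of formal convex combinations $\sum_n t_nz_n$ with $t_n\ge 0$, only finitely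 many $t_n$ nonzero, $\sum_n t_n=1$, where $z_n\in Z$ is given only for those $n$ with $t_n>0$. It carries the coarsest topology for which all $t_n$ are continuous and all coordinates $z_n\colon \{t_n>0\}\to Z$ are continuous, and $G$ acts on it through the $z_n$. \textbf{Theorem.} Let $\mathcal F$ be a family of subgroups of $G$. \begin{enumerate} \item There exists a model for $J_{\mathcal F}(G)$ all of whose isotropy groups belong to $\mathcal F$. One such model is the infinite join $\ast_{n=1}^{\infty}Z$ of $Z=\coprod_{H\in\mathcal F}G/H$. \item Let $X$ be an $\mathcal F$-numerable $G$-space and give $X\times X$ the diagonal action. Then $X$ is a model for $J_{\mathcal F}(G)$ if and only if for each $H\in\mathcal F$ there is $x\in X$ with $H\subseteq G_x$ (where $G_x$ is the isotropy group of $x$), and the two projections $\mathrm{pr}_1,\mathrm{pr}_2\colon X\times X\to X$ are $G$-homotopic. \item If $X$ is a model for $J_{\mathcal F}(G)$ and $H\in\mathcal F$, then the fixed point set $X^H$ is contractible. \end{enumerate} -/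

import Mathlib

open Set Topology

namespace EquivariantTopology

/-- A family of subgroups of `G`: a set of closed subgroups which is closed under conjugation and
under intersections of finitely many (at least one) members. -/
structure SubgroupFamily (G : Type*) [Group G] [TopologicalSpace G] where
  carrier : Set (Subgroup G)
  isClosed_of_mem : ∀ H ∈ carrier, IsClosed (H : Set G)
  conj_mem : ∀ H ∈ carrier, ∀ g : G, H.map (MulAut.conj g).toMonoidHom ∈ carrier
  inf_mem : ∀ H ∈ carrier, ∀ K ∈ carrier, H ⊓ K ∈ carrier

instance {G : Type*} [Group G] [TopologicalSpace G] : Membership (Subgroup G) (SubgroupFamily G) :=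
  ⟨fun F H => H ∈ F.carrier⟩

/-- A `G`-map: a continuous `G`-equivariant map. -/
structure GMap (G X Y : Type*) [Group G] [TopologicalSpace X] [MulAction G X]
    [TopologicalSpace Y] [MulAction G Y] extends C(X, Y) where
  map_smul : ∀ (g : G) (x : X), toFun (g • x) = g • toFun x

/-- Two `G`-maps are `G`-homotopic if they are joined by a homotopy `[0,1] × X → Y` which is
`G`-equivariant for the trivial action on `[0,1]`. -/
def GHomotopic {G X Y : Type*} [Group G] [TopologicalSpace X] [MulAction G X]
    [TopologicalSpace Y] [MulAction G Y] (f₀ f₁ : GMap G X Y) : Prop :=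
  ∃ h : f₀.toContinuousMap.Homotopy f₁.toContinuousMap,
    ∀ (t : unitInterval) (g : G) (x : X), h (t, g • x) = g • h (t, x)

/-- The first projection `X × X → X`, for the diagonal action on `X × X`. -/
def GMap.pr₁ (G X : Type*) [Group G] [TopologicalSpace X] [MulAction G X] : GMap G (X × X) X where
  toFun := Prod.fst
  continuous_toFun := continuous_fst
  map_smul _ _ := rfl

/-- The second projection `X × X → X`, for the diagonal action on `X × X`. -/
def GMap.pr₂ (G X : Type*) [Group G] [TopologicalSpace X] [MulAction G X] : GMap G (X × X) X where
  toFun := Prod.snd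
  continuous_toFun := continuous_snd
  map_smul _ _ := rfl

/-- `X` is `F`-numerable: there is an open covering by `G`-subspaces `U i`, each with a `G`-map
`U i → G ⧸ H` for some `H` in `F`, and a subordinate locally finite partition of unity by
`G`-invariant functions. -/
def IsNumerable.{u, w} {G : Type u} [Group G] [TopologicalSpace G] (F : SubgroupFamily G)
    (X : Type w) [TopologicalSpace X] [MulAction G X] : Prop :=
  ∃ (I : Type w) (U : I → SubMulAction G X) (e : PartitionOfUnity I X),
    (∀ i, IsOpen (U i : Set X)) ∧
    (⋃ i, (U i : Set X)) = univ ∧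
    (∀ i, ∃ H ∈ F, Nonempty (GMap G (U i) (G ⧸ H))) ∧
    e.IsSubordinate (fun i => (U i : Set X)) ∧
    ∀ (i : I) (g : G) (x : X), e i (g • x) = e i x

/-- `X` is a model for the classifying numerable `G`-space of the family `F`: it is `F`-numerable
and every `F`-numerable (Hausdorff) `G`-space `Y` in the universe `v` has, up to `G`-homotopy,
precisely one `G`-map to `X`. -/
def IsClassifyingNumerable.{u, w, v} {G : Type u} [Group G] [TopologicalSpace G]
    (F : SubgroupFamily G) (X : Type w) [TopologicalSpace X] [MulAction G X] : Prop :=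
  IsNumerable F X ∧
  ∀ (Y : Type v) [TopologicalSpace Y] [T2Space Y] [MulAction G Y] [ContinuousSMul G Y],
    IsNumerable F Y →
      Nonempty (GMap G Y X) ∧ ∀ f₀ f₁ : GMap G Y X, GHomotopic f₀ f₁

/-- The infinite join `Z * Z * Z * ⋯`. A point is a formal convex combination `∑ tₙ zₙ` with
finitely many nonzero weights; the coordinate `zₙ` exists only where `tₙ > 0`. -/
structure InfiniteJoin (Z : Type*) where
  weight : ℕ →₀ ℝ
  weight_nonneg : ∀ n, 0 ≤ weight n
  weight_sum : (weight.sum fun _ t => t) = 1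
  coord : ∀ n, 0 < weight n → Z

namespace InfiniteJoin

/-- The coarsest topology for which all weights `tₙ` and all coordinates
`zₙ : {x | 0 < tₙ x} → Z` are continuous, the sets `{x | 0 < tₙ x}` being open. -/
instance (Z : Type*) [TopologicalSpace Z] : TopologicalSpace (InfiniteJoin Z) :=
  .generateFrom
    ({s | ∃ (n : ℕ) (V : Set ℝ), IsOpen V ∧ s = {x | x.weight n ∈ V}} ∪
     {s | ∃ (n : ℕ) (V : Set Z), IsOpen V ∧ s = {x | ∃ h : 0 < x.weight n, x.coord n h ∈ V}})

/-- The action of `G` on all coordinates at once. -/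
instance (G Z : Type*) [Group G] [MulAction G Z] : MulAction G (InfiniteJoin Z) where
  smul g x := ⟨x.weight, x.weight_nonneg, x.weight_sum, fun n h => g • x.coord n h⟩
  one_smul x := by
    change InfiniteJoin.mk _ _ _ _ = _
    simp
  mul_smul g g' x := by
    change InfiniteJoin.mk _ _ _ _ = InfiniteJoin.mk _ _ _ _
    congr 1
    funext n h
    exact mul_smul _ _ _

theorem continuous_weight {Z : Type*} [TopologicalSpace Z] (n : ℕ) :
    Continuous fun x : InfiniteJoin Z => x.weight n :=
  ⟨fun V hV => .basic _ (.inl ⟨n, V, hV, rfl⟩)⟩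

theorem isOpen_coord {Z : Type*} [TopologicalSpace Z] (n : ℕ) {V : Set Z} (hV : IsOpen V) :
    IsOpen {x : InfiniteJoin Z | ∃ h : 0 < x.weight n, x.coord n h ∈ V} :=
  .basic _ (.inr ⟨n, V, hV, rfl⟩)

instance (G Z : Type*) [Group G] [TopologicalSpace G] [MulAction G Z] [TopologicalSpace Z]
    [ContinuousSMul G Z] : ContinuousSMul G (InfiniteJoin Z) where
  continuous_smul := by
    refine continuous_generateFrom_iff.2 ?_
    rintro s (⟨n, V, hV, rfl⟩ | ⟨n, V, hV, rfl⟩)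
    · exact hV.preimage ((continuous_weight n).comp continuous_snd)
    · rw [isOpen_iff_mem_nhds]
      rintro ⟨g, x⟩ ⟨h, hx⟩
      have h1 : IsOpen {p : G × Z | p.1 • p.2 ∈ V} := hV.preimage continuous_smul
      obtain ⟨A, B, hA, hB, hgA, hxB, hAB⟩ := isOpen_prod_iff.1 h1 g (x.coord n h) hx
      filter_upwards [prod_mem_nhds (hA.mem_nhds hgA)
        ((isOpen_coord n hB).mem_nhds (x := x) ⟨h, hxB⟩)]
      rintro ⟨g', x'⟩ ⟨hg', h', hx'⟩
      exact ⟨h', hAB (mk_mem_prod hg' hx')⟩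

instance (Z : Type*) [TopologicalSpace Z] [T2Space Z] : T2Space (InfiniteJoin Z) where
  t2 := by
    rintro ⟨t, ht0, ht1, z⟩ ⟨t', ht0', ht1', z'⟩ hne
    by_cases htt : t = t'
    · subst htt
      have : ∃ n h, z n h ≠ z' n h := by
        by_contra! hc
        exact hne (by congr 1; funext n h; exact hc n h)
      obtain ⟨n, h, hz⟩ := this
      obtain ⟨A, B, hA, hB, hzA, hzB, hAB⟩ := t2_separation hz
      refine ⟨_, _, isOpen_coord n hA, isOpen_coord n hB, ⟨h, hzA⟩, ⟨h, hzB⟩, ?_⟩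
      rw [Set.disjoint_left]
      rintro x ⟨h1, h2⟩ ⟨_, h3⟩
      exact Set.disjoint_left.1 hAB h2 h3
    · obtain ⟨n, hn⟩ : ∃ n, t n ≠ t' n := by
        by_contra! hc
        exact htt (Finsupp.ext hc)
      exact separated_by_continuous (continuous_weight n) hn

end InfiniteJoin

/-- The disjoint union of the homogeneous spaces `G ⧸ H` over all `H` in `F`. -/
abbrev OrbitSum {G : Type*} [Group G] [TopologicalSpace G] (F : SubgroupFamily G) : Type _ :=
  Σ H : {H : Subgroup G // H ∈ F}, G ⧸ H.1

instance {G : Type*} [Group G] [TopologicalSpace G] [IsTopologicalGroup G]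
    (F : SubgroupFamily G) : ContinuousSMul G (OrbitSum F) where
  continuous_smul := by
    rw [continuous_iff_continuousAt]
    rintro ⟨g, H, q⟩
    let j : G ⧸ H.1 → OrbitSum F := fun q => ⟨H, q⟩
    have hj : IsOpenEmbedding j :=
      .sigmaMk (σ := fun H : {H : Subgroup G // H ∈ F} => G ⧸ H.1)
    have h1 : IsOpenEmbedding (Prod.map id j : G × (G ⧸ H.1) → G × OrbitSum F) :=
      IsOpenEmbedding.id.prodMap hj
    refine (h1.continuousAt_iff (x := (g, q))).1 ?_
    exact (hj.continuous.comp
      (continuous_smul : Continuous fun p : G × (G ⧸ H.1) => p.1 • p.2)).continuousAt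

instance {G : Type*} [Group G] [TopologicalSpace G] [IsTopologicalGroup G]
    (F : SubgroupFamily G) (H : {H : Subgroup G // H ∈ F}) : T2Space (G ⧸ H.1) := by
  rw [t2Space_iff_of_isOpenQuotientMap (QuotientGroup.isOpenQuotientMap_mk (N := H.1))]
  have h1 := (F.isClosed_of_mem H.1 H.2).preimage
    (by fun_prop : Continuous fun p : G × G => p.1⁻¹ * p.2)
  convert h1 using 1
  ext ⟨a, b⟩
  exact QuotientGroup.eq

end EquivariantTopology

open EquivariantTopology

universe u v w

/-! Everything rests on one criterion: a numerable `X` is a model as soon as it has an `H`-fixed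
point for every `H` in the family and its two projections `X × X → X` are `G`-homotopic. Such a
homotopy is an equivariant continuous choice of a path between any two points. Composed with two
`G`-maps `Y → X` it joins them, which is uniqueness. For existence, the local maps `U i → G ⧸ H →
X`, the second being the orbit map of a fixed point, are glued along these paths with the partition
of unity as weights (`nonempty_gmap_of_isNumerable`). Conversely, testing a model on `G ⧸ H` yields
the fixed point and testing it on `X × X` yields the homotopy. Freezing the second end point of the
paths at an `H`-fixed point contracts the fixed point set.

For the infinite join the path from `x` to `y` is `InfiniteJoin.mix`: push the coordinates of `x` to
the even places, shift the weight linearly to the coordinates of `y` placed at the odd places, and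
move these back. The push involves infinitely many places, so `spread` distributes it over the
intervals `[1 / (k + 1), 1 / k]`, far coordinates moving first. Numerability comes from a locally
finite partition of unity subordinate to the sets `tₙ > 0` (`InfiniteJoin.exists_partitionOfUnity`),
split according to the orbit containing `zₙ`. -/

namespace EquivariantTopology

/-! ### Interpolating finitely many points along chosen paths. -/

section Interpolation

variable {I X Y : Type*} [TopologicalSpace X]

/-- The iterated interpolation of the points `g i y`, with weights `e i y`, for `i` in a list,
along a path `h (·, x, x')` from `x` to `x'` for any two points `x`, `x'`. -/
noncomputable def interpolate (h : C(unitInterval × (X × X), X)) (e : I → Y → ℝ) (g : I → Y → X)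
    (x₀ : X) : List I → Y → X
  | [], _ => x₀
  | i :: L, y =>
    h (projIcc 0 1 zero_le_one
        (3 * ((L.map (e · y)).sum / (e i y + (L.map (e · y)).sum)) - 1),
      g i y, interpolate h e g x₀ L y)

variable {h : C(unitInterval × (X × X), X)} {e : I → Y → ℝ} {g : I → Y → X} {x₀ : X}

theorem sum_map_nonneg (he : ∀ i y, 0 ≤ e i y) (L : List I) (y : Y) :
    0 ≤ (L.map (e · y)).sum := by
  refine List.sum_nonneg fun a ha => ?_
  obtain ⟨i, -, rfl⟩ := List.mem_map.1 ha
  exact he i y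

theorem interpolate_cons_of_eq_zero_left (h1 : ∀ q : X × X, h (1, q) = q.2) {i : I} {L : List I}
    {y : Y} (hi : e i y = 0) (hL : 0 < (L.map (e · y)).sum) :
    interpolate h e g x₀ (i :: L) y = interpolate h e g x₀ L y := by
  rw [interpolate, hi, zero_add, div_self hL.ne', projIcc_of_right_le zero_le_one (by norm_num)]
  exact h1 _

theorem interpolate_cons_of_eq_zero_right (h0 : ∀ q : X × X, h (0, q) = q.1) {i : I} {L : List I}
    {y : Y} (hL : (L.map (e · y)).sum = 0) :
    interpolate h e g x₀ (i :: L) y = g i y := by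
  rw [interpolate, hL, zero_div, projIcc_of_le_left zero_le_one (by norm_num)]
  exact h0 _

/-- If `r` is the share of the tail in the total weight, the parameter `3 * r - 1` freezes the path
on the outer thirds: for `r ≥ 2 / 3` the value is that of the tail, for `r ≤ 1 / 3` it is `g i`. A
term is thus discarded before its weight reaches zero, and nothing is needed of `g i` where `e i`
vanishes. -/
theorem continuousAt_interpolate [TopologicalSpace Y] (h0 : ∀ q : X × X, h (0, q) = q.1)
    (h1 : ∀ q : X × X, h (1, q) = q.2) (he : ∀ i, Continuous (e i)) (he' : ∀ i y, 0 ≤ e i y)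
    (hg : ∀ i y, 0 < e i y → ContinuousAt (g i) y) (L : List I) (y : Y)
    (hy : 0 < (L.map (e · y)).sum) : ContinuousAt (interpolate h e g x₀ L) y := by
  induction L with
  | nil => simp at hy
  | cons i L ih =>
    have hs : Continuous fun y => (L.map (e · y)).sum :=
      continuous_list_sum L fun i _ => he i
    rw [List.map_cons, List.sum_cons] at hy
    have hr : ContinuousAt
        (fun y => (L.map (e · y)).sum / (e i y + (L.map (e · y)).sum)) y :=
      hs.continuousAt.div ((he i).add hs).continuousAt hy.ne'
    rcases (he' i y).eq_or_lt with hi | hi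
    · rw [← hi, zero_add] at hy
      refine (ih hy).congr ?_
      have : ∀ᶠ y in 𝓝 y,
          2 / 3 < (L.map (e · y)).sum / (e i y + (L.map (e · y)).sum) := by
        refine hr.eventually_const_lt ?_
        simp only [← hi, zero_add, div_self hy.ne']; norm_num
      filter_upwards [this] with y' hy'
      rw [interpolate, projIcc_of_right_le zero_le_one (by linarith)]
      exact (h1 (_, _)).symm
    rcases (sum_map_nonneg he' L y).eq_or_lt with hL | hL
    · refine (hg i y hi).congr ?_
      have : ∀ᶠ y in 𝓝 y,
          (L.map (e · y)).sum / (e i y + (L.map (e · y)).sum) < 1 / 3 := by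
        refine hr.eventually_lt_const ?_
        simp only [← hL, zero_div]; norm_num
      filter_upwards [this] with y' hy'
      rw [interpolate, projIcc_of_le_left zero_le_one (by linarith)]
      exact (h0 (_, _)).symm
    · have := (continuous_projIcc (h := zero_le_one' ℝ)).continuousAt.comp
        ((continuousAt_const.mul hr).sub continuousAt_const : ContinuousAt
        (fun y => 3 * ((L.map (e · y)).sum / (e i y + (L.map (e · y)).sum)) - 1) y)
      exact h.continuous.continuousAt.comp (this.prodMk ((hg i y hi).prodMk (ih hL)))

theorem sum_map_filter (p : I → Bool) (L : List I) (y : Y)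
    (hp : ∀ i, p i = false → e i y = 0) :
    ((L.filter p).map (e · y)).sum = (L.map (e · y)).sum := by
  induction L with
  | nil => rfl
  | cons i L ih =>
    cases hi : p i
    · simp [hi, ih, hp i hi]
    · simp [hi, ih]

/-- A term of weight zero is skipped when the tail has positive sum, and a tail of sum zero is never
consulted. So enlarging a list by terms of weight zero at `y` does not change the value at `y`. -/
theorem interpolate_filter (h0 : ∀ q : X × X, h (0, q) = q.1)
    (h1 : ∀ q : X × X, h (1, q) = q.2) (he' : ∀ i y, 0 ≤ e i y) (p : I → Bool) (L : List I) (y : Y)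
    (hp : ∀ i, p i = false → e i y = 0) (hy : 0 < (L.map (e · y)).sum) :
    interpolate h e g x₀ (L.filter p) y = interpolate h e g x₀ L y := by
  induction L with
  | nil => rfl
  | cons i L ih =>
    cases hi : p i
    · have hy' : 0 < (L.map (e · y)).sum := by simpa [hp i hi] using hy
      rw [List.filter_cons_of_neg (by simp [hi]), ih hy',
        interpolate_cons_of_eq_zero_left h1 (hp i hi) hy']
    · rw [List.filter_cons_of_pos hi]
      rcases (sum_map_nonneg he' L y).eq_or_lt with hL | hL
      · rw [interpolate_cons_of_eq_zero_right h0 hL.symm,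
          interpolate_cons_of_eq_zero_right h0 (by rw [sum_map_filter p L y hp, ← hL])]
      · rw [interpolate, interpolate, sum_map_filter p L y hp, ih hL]

/-- `g i` is equivariant only where `0 < e i`, and the induction needs a tail of positive sum; the
formulas for weight zero settle the two degenerate cases. -/
theorem interpolate_smul {G : Type*} [Group G] [MulAction G X] [MulAction G Y]
    (h0 : ∀ q : X × X, h (0, q) = q.1) (h1 : ∀ q : X × X, h (1, q) = q.2)
    (hG : ∀ (t : unitInterval) (a : G) (q : X × X), h (t, a • q) = a • h (t, q))
    (he' : ∀ i y, 0 ≤ e i y) (heG : ∀ i (a : G) y, e i (a • y) = e i y)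
    (hg : ∀ i (a : G) y, 0 < e i y → g i (a • y) = a • g i y) (a : G) (L : List I) (y : Y)
    (hy : 0 < (L.map (e · y)).sum) :
    interpolate h e g x₀ L (a • y) = a • interpolate h e g x₀ L y := by
  have hs (L : List I) : (L.map (e · (a • y))).sum = (L.map (e · y)).sum := by simp only [heG]
  induction L with
  | nil => simp at hy
  | cons i L ih =>
    rcases (he' i y).eq_or_lt with hi | hi
    · have hy' : 0 < (L.map (e · y)).sum := by simpa [← hi] using hy
      rw [interpolate_cons_of_eq_zero_left h1 hi.symm hy',
        interpolate_cons_of_eq_zero_left h1 (by rw [heG, ← hi]) (by rwa [hs]), ih hy']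
    rcases (sum_map_nonneg he' L y).eq_or_lt with hL | hL
    · rw [interpolate_cons_of_eq_zero_right h0 hL.symm,
        interpolate_cons_of_eq_zero_right h0 (by rw [hs, ← hL]), hg i a y hi]
    · rw [interpolate, interpolate, ih hL, hg i a y hi, hs, heG, ← hG]
      rfl

end Interpolation

/-! ### Maps into a space whose projections are homotopic. -/

theorem sort_filter {I : Type*} [LinearOrder I] (S T : Finset I) (h : T ⊆ S) :
    (S.sort (· ≤ ·)).filter (· ∈ T) = T.sort (· ≤ ·) := by
  refine List.Perm.eq_of_pairwise' (r := (· ≤ ·)) ((S.pairwise_sort _).filter _)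
    (T.pairwise_sort _) ?_
  rw [List.perm_ext_iff_of_nodup ((S.sort_nodup _).filter _) (T.sort_nodup _)]
  intro i
  simpa using fun hi => h hi

/-- The orbit map `G ⧸ H → X` of a point fixed by `H`. -/
def GMap.ofStabilizer {G X : Type*} [Group G] [TopologicalSpace G] [TopologicalSpace X]
    [MulAction G X] [ContinuousSMul G X] (H : Subgroup G) (x : X)
    (hx : H ≤ MulAction.stabilizer G x) : GMap G (G ⧸ H) X where
  toFun := Quotient.lift (fun g : G => g • x) (by
    intro a b hab
    have := hx (QuotientGroup.leftRel_apply.1 hab)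
    rw [MulAction.mem_stabilizer_iff, mul_smul, inv_smul_eq_iff] at this
    exact this.symm)
  continuous_toFun := (by fun_prop : Continuous fun g : G => g • x).quotient_lift _
  map_smul g q := by
    induction q using Quotient.inductionOn with
    | h a => exact mul_smul g a x

/-- A space with points fixed by all members of the family, and whose two projections are
homotopic, receives a `G`-map from every numerable space. -/
theorem nonempty_gmap_of_isNumerable {G X Y : Type*} [Group G] [TopologicalSpace G]
    (F : SubgroupFamily G) [TopologicalSpace X] [MulAction G X] [ContinuousSMul G X]
    [TopologicalSpace Y] [MulAction G Y]
    (hX : ∀ H ∈ F, ∃ x : X, H ≤ MulAction.stabilizer G x)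
    (hpr : GHomotopic (GMap.pr₁ G X) (GMap.pr₂ G X)) (hY : IsNumerable F Y) :
    Nonempty (GMap G Y X) := by
  classical
  obtain ⟨I, U, e, hUo, hU, hUG, heU, heG⟩ := hY
  obtain ⟨h, hG⟩ := hpr
  -- The default value `x₀` comes from a point of `Y`; for an empty family `X` could be empty.
  rcases isEmpty_or_nonempty Y with hYe | ⟨⟨y₀⟩⟩
  · exact ⟨⟨⟨isEmptyElim, continuous_of_const fun y => isEmptyElim y⟩, fun _ y => isEmptyElim y⟩⟩
  have key (i : I) : Nonempty (GMap G (U i) X) := by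
    obtain ⟨H, hH, ⟨f⟩⟩ := hUG i
    obtain ⟨x, hx⟩ := hX H hH
    exact ⟨⟨(GMap.ofStabilizer H x hx).toContinuousMap.comp f.toContinuousMap, fun g y =>
      (congrArg _ (f.map_smul g y)).trans ((GMap.ofStabilizer H x hx).map_smul g _)⟩⟩
  let γ (i : I) : GMap G (U i) X := (key i).some
  obtain ⟨i₀, hi₀⟩ := mem_iUnion.1 (hU ▸ mem_univ y₀)
  let x₀ : X := (γ i₀).toFun ⟨y₀, hi₀⟩
  let g (i : I) (y : Y) : X := if hy : y ∈ U i then (γ i).toFun ⟨y, hy⟩ else x₀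
  have hg (i : I) (y : Y) (hy : 0 < e i y) : ContinuousAt (g i) y := by
    have hyU : y ∈ (U i : Set Y) := heU i (subset_tsupport _ hy.ne')
    have : ContinuousOn (g i) (U i : Set Y) := by
      refine continuousOn_iff_continuous_domRestrict.2 ((γ i).continuous_toFun.congr fun y => ?_)
      simp [g, Set.domRestrict]
    exact this.continuousAt ((hUo i).mem_nhds hyU)
  have hgG (i : I) (a : G) (y : Y) (hy : 0 < e i y) : g i (a • y) = a • g i y := by
    have hyU : y ∈ U i := heU i (subset_tsupport _ hy.ne')
    have hyU' : a • y ∈ U i := (U i).smul_mem a hyU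
    simp only [g, dif_pos hyU, dif_pos hyU']
    exact (γ i).map_smul a ⟨y, hyU⟩
  have h0 (q : X × X) : h.toContinuousMap (0, q) = q.1 := h.apply_zero q
  have h1 (q : X × X) : h.toContinuousMap (1, q) = q.2 := h.apply_one q
  -- The interpolation depends on the order of its terms. One order on all of `I` makes the sorted
  -- lists of nested finite sets compatible under filtering.
  let _ : LinearOrder I := linearOrderOfSTO WellOrderingRel
  let P := interpolate h.toContinuousMap (fun i y => e i y) g x₀
  let f (y : Y) : X := P ((e.finsupport y).sort (· ≤ ·)) y
  have hsum (S : Finset I) (y : Y) :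
      ((S.sort (· ≤ ·)).map (e · y)).sum = ∑ i ∈ S, e i y := by
    rw [← Finset.sum_map_toList]
    exact ((Finset.sort_perm_toList S (· ≤ ·)).map _).sum_eq
  have hf {S : Finset I} {y : Y} (hS : Function.support (e · y) ⊆ S) :
      0 < ((S.sort (· ≤ ·)).map (e · y)).sum ∧ f y = P (S.sort (· ≤ ·)) y := by
    have hpos : 0 < ((S.sort (· ≤ ·)).map (e · y)).sum := by
      rw [hsum, ← finsum_eq_sum_of_support_subset _ hS, e.sum_eq_one (mem_univ y)]
      exact one_pos
    refine ⟨hpos, ?_⟩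
    have hsub : e.finsupport y ⊆ S := fun i hi => hS (by simpa using hi)
    simp only [f]
    rw [← sort_filter S _ hsub]
    refine interpolate_filter h0 h1 (fun i y => e.nonneg i y) _ _ y (fun i hi => ?_) hpos
    simpa using hi
  have hfG (a : G) (y : Y) : f (a • y) = a • f y := by
    have hS : Function.support (e · y) ⊆ e.finsupport y := by simp
    have hS' : Function.support (e · (a • y)) ⊆ e.finsupport y := by
      simpa only [heG] using hS
    rw [(hf hS').2, (hf hS).2]
    exact interpolate_smul h0 h1 hG (fun i y => e.nonneg i y) heG hgG a _ y (hf hS).1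
  refine ⟨⟨⟨f, continuous_iff_continuousAt.2 fun y => ?_⟩, hfG⟩⟩
  -- Near `y` a single finite set contains all active indices, so there `f` is one interpolation
  -- along a fixed list.
  obtain ⟨S, hS⟩ := e.exists_finset_nhds y
  have hP : ContinuousAt (P (S.sort (· ≤ ·))) y :=
    continuousAt_interpolate h0 h1 (fun i => (e i).continuous)
      (fun i y => e.nonneg i y) hg (S.sort (· ≤ ·)) y (hf hS.self_of_nhds.2).1
  refine hP.congr ?_
  filter_upwards [hS] with y' hy'
  exact (hf hy'.2).2.symm

/-- Two `G`-maps into a space whose two projections are homotopic are homotopic. -/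
theorem gHomotopic_of_pr {G X Y : Type*} [Group G] [TopologicalSpace X] [MulAction G X]
    [TopologicalSpace Y] [MulAction G Y] (hpr : GHomotopic (GMap.pr₁ G X) (GMap.pr₂ G X))
    (f₀ f₁ : GMap G Y X) : GHomotopic f₀ f₁ := by
  obtain ⟨h, hG⟩ := hpr
  refine ⟨⟨⟨fun p => h (p.1, f₀.toFun p.2, f₁.toFun p.2), ?_⟩, fun y => ?_, fun y => ?_⟩, ?_⟩
  · have := f₀.continuous_toFun
    have := f₁.continuous_toFun
    fun_prop
  · exact h.apply_zero _
  · exact h.apply_one _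
  · intro t g y
    change h (t, f₀.toFun (g • y), f₁.toFun (g • y)) = g • h (t, f₀.toFun y, f₁.toFun y)
    rw [f₀.map_smul, f₁.map_smul]
    exact hG t g (f₀.toFun y, f₁.toFun y)

theorem isClassifyingNumerable_of_pr {G : Type u} [Group G] [TopologicalSpace G]
    (F : SubgroupFamily G) (X : Type w) [TopologicalSpace X] [MulAction G X] [ContinuousSMul G X]
    (hX : IsNumerable F X) (hst : ∀ H ∈ F, ∃ x : X, H ≤ MulAction.stabilizer G x)
    (hpr : GHomotopic (GMap.pr₁ G X) (GMap.pr₂ G X)) : IsClassifyingNumerable.{u, w, v} F X :=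
  ⟨hX, fun _ _ _ _ _ hY => ⟨nonempty_gmap_of_isNumerable F hst hpr hY, gHomotopic_of_pr hpr⟩⟩

/-! ### Numerable test spaces and necessity of the two conditions. -/

/-- Numerability is inherited along `G`-maps. -/
theorem IsNumerable.comap {G : Type u} [Group G] [TopologicalSpace G]
    {F : SubgroupFamily G} {X : Type w} [TopologicalSpace X] [MulAction G X]
    {Y : Type max v w} [TopologicalSpace Y] [MulAction G Y] (f : GMap G Y X)
    (hX : IsNumerable F X) : IsNumerable F Y := by
  obtain ⟨I, U, e, hUo, hU, hUG, heU, heG⟩ := hX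
  have hf : Continuous f.toFun := f.continuous_toFun
  -- The index type must live in the universe of `Y`.
  refine ⟨ULift.{v} I, fun i => ⟨f.toFun ⁻¹' U i.down, fun g y hy => ?_⟩,
    { toFun := fun i => (e i.down).comp f.toContinuousMap
      locallyFinite' := ?_
      nonneg' := fun i y => e.nonneg _ _
      sum_eq_one' := fun y _ => ?_
      sum_le_one' := fun y => ?_ }, fun i => (hUo _).preimage hf, ?_, fun i => ?_, fun i => ?_,
      fun i g y => ?_⟩
  · change f.toFun (g • y) ∈ U i.down
    rw [f.map_smul]
    exact (U i.down).smul_mem g hy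
  · exact (e.locallyFinite.preimage_continuous hf).comp_injective ULift.down_injective
  · rw [← e.sum_eq_one (mem_univ (f.toFun y))]
    exact finsum_comp_equiv (Equiv.ulift (α := I)) (f := fun i => e i (f.toFun y))
  · refine le_of_eq_of_le ?_ (e.sum_le_one (f.toFun y))
    exact finsum_comp_equiv (Equiv.ulift (α := I)) (f := fun i => e i (f.toFun y))
  · refine eq_univ_of_forall fun y => mem_iUnion.2 ?_
    obtain ⟨i, hi⟩ := mem_iUnion.1 (hU ▸ mem_univ (f.toFun y))
    exact ⟨⟨i⟩, hi⟩
  · obtain ⟨H, hH, ⟨q⟩⟩ := hUG i.down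
    refine ⟨H, hH, ⟨⟨⟨fun y => q.toFun ⟨f.toFun y.1, y.2⟩, ?_⟩, fun g y => ?_⟩⟩⟩
    · exact q.continuous_toFun.comp ((hf.comp continuous_subtype_val).subtype_mk _)
    · refine Eq.trans (congrArg q.toFun (Subtype.ext ?_)) (q.map_smul g _)
      exact f.map_smul g y.1
  · exact (tsupport_comp_subset_preimage _ hf).trans (preimage_mono (heU i.down))
  · exact (congrArg (e i.down) (f.map_smul g y)).trans (heG _ _ _)

theorem isNumerable_quotient {G : Type u} [Group G] [TopologicalSpace G]
    (F : SubgroupFamily G) {H : Subgroup G} (hH : H ∈ F) : IsNumerable F (G ⧸ H) := by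
  refine ⟨PUnit, fun _ => ⊤,
    { toFun := fun _ => 1
      locallyFinite' := locallyFinite_of_finite _
      nonneg' := fun i y => zero_le_one
      sum_eq_one' := fun y _ => finsum_unique _
      sum_le_one' := fun y => (finsum_unique _).le }, fun _ => isOpen_univ, iUnion_const _, fun _ =>
      ⟨H, hH, ⟨⟨⟨Subtype.val, continuous_subtype_val⟩, fun _ _ => rfl⟩⟩⟩,
      fun _ => subset_univ _, fun _ _ _ => rfl⟩

instance {G X : Type*} [TopologicalSpace G] [TopologicalSpace X] [SMul G X] [ContinuousSMul G X] :
    ContinuousSMul G (ULift X) where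
  continuous_smul := continuous_uliftUp.comp
    (continuous_fst.smul (continuous_uliftDown.comp continuous_snd))

/-- The projection `ULift X → X` as a `G`-map. -/
def GMap.down (G X : Type*) [Group G] [TopologicalSpace X] [MulAction G X] :
    GMap G (ULift X) X where
  toFun := ULift.down
  continuous_toFun := continuous_uliftDown
  map_smul _ _ := rfl

/-- A `G`-map out of the numerable space `G ⧸ H` sends the coset of `1` to a point fixed by `H`. -/
theorem IsClassifyingNumerable.exists_le_stabilizer {G : Type u} [Group G]
    [TopologicalSpace G] [IsTopologicalGroup G] (F : SubgroupFamily G) (X : Type w)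
    [TopologicalSpace X] [MulAction G X] (hX : IsClassifyingNumerable.{u, w, max u v w} F X) :
    ∀ H ∈ F, ∃ x : X, H ≤ MulAction.stabilizer G x := by
  intro H hH
  have : T2Space (G ⧸ H) :=
    (fun K : {H : Subgroup G // H ∈ F} => (inferInstance : T2Space (G ⧸ K.1))) ⟨H, hH⟩
  obtain ⟨⟨f⟩, -⟩ := hX.2 (ULift.{max v w} (G ⧸ H))
    (IsNumerable.comap.{u, max v w, u} (GMap.down G (G ⧸ H)) (isNumerable_quotient F hH))
  refine ⟨f.toFun ⟨((1 : G) : G ⧸ H)⟩, fun a ha => ?_⟩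
  rw [MulAction.mem_stabilizer_iff, ← f.map_smul]
  refine congrArg f.toFun (congrArg ULift.up ?_)
  change ((a * 1 : G) : G ⧸ H) = _
  rw [mul_one]
  exact (QuotientGroup.eq.2 (by simpa using ha)).symm

/-- `X × X` is numerable through its first projection, so uniqueness applies to the two projections.
-/
theorem IsClassifyingNumerable.gHomotopic_pr {G : Type u} [Group G]
    [TopologicalSpace G] (F : SubgroupFamily G) (X : Type w)
    [TopologicalSpace X] [T2Space X] [MulAction G X] [ContinuousSMul G X]
    (hX : IsClassifyingNumerable.{u, w, max u v w} F X) :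
    GHomotopic (GMap.pr₁ G X) (GMap.pr₂ G X) := by
  have hn : IsNumerable F (ULift.{max u v} (X × X)) :=
    (hX.1.comap (GMap.pr₁ G X)).comap (GMap.down G (X × X))
  let f (p : GMap G (X × X) X) : GMap G (ULift.{max u v} (X × X)) X :=
    ⟨p.toContinuousMap.comp (GMap.down G (X × X)).toContinuousMap, fun g y => p.map_smul g y.down⟩
  obtain ⟨h, hG⟩ := (hX.2 _ hn).2 (f (GMap.pr₁ G X)) (f (GMap.pr₂ G X))
  refine ⟨⟨⟨fun p => h (p.1, ⟨p.2⟩), ?_⟩, fun y => h.apply_zero ⟨y⟩, fun y => h.apply_one ⟨y⟩⟩,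
    fun t g y => hG t g ⟨y⟩⟩
  exact h.continuous.comp (continuous_fst.prodMk (continuous_uliftUp.comp continuous_snd))

/-- The path from an `H`-fixed `y` to `x₀` stays in the fixed point set, because `H` fixes both end
points and the choice of path is equivariant. -/
theorem contractibleSpace_fixedPoints {G X : Type*} [Group G] [TopologicalSpace X] [MulAction G X]
    (hpr : GHomotopic (GMap.pr₁ G X) (GMap.pr₂ G X)) (H : Subgroup G)
    (hH : ∃ x : X, H ≤ MulAction.stabilizer G x) :
    ContractibleSpace (MulAction.fixedPoints H X) := by
  obtain ⟨x₀, hx₀⟩ := hH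
  obtain ⟨h, hG⟩ := hpr
  have hx₀' : x₀ ∈ MulAction.fixedPoints H X := fun a => hx₀ a.2
  refine contractible_iff_id_nullhomotopic _ |>.2 ⟨⟨x₀, hx₀'⟩,
    ⟨⟨⟨fun p => ⟨h (p.1, p.2.1, x₀), fun a => ?_⟩, ?_⟩, fun y => ?_, fun y => ?_⟩⟩⟩
  · have := hG p.1 a.1 (p.2.1, x₀)
    have h2 : a.1 • (p.2.1, x₀) = (p.2.1, x₀) := Prod.ext (p.2.2 a) (hx₀' a)
    rw [h2] at this
    exact this.symm
  · refine Continuous.subtype_mk ?_ _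
    fun_prop
  · exact Subtype.ext (h.apply_zero _)
  · exact Subtype.ext (h.apply_one _)


/-! ### Spreading coordinates to the even or odd places. -/

/-- The retraction of the real line onto `[0,1]`. -/
noncomputable def clamp (t : ℝ) : ℝ := max 0 (min 1 t)

@[fun_prop]
theorem continuous_clamp : Continuous clamp := by unfold clamp; fun_prop

theorem clamp_nonneg (t : ℝ) : 0 ≤ clamp t := le_max_left _ _

theorem clamp_le_one (t : ℝ) : clamp t ≤ 1 := max_le zero_le_one (min_le_left _ _)

theorem clamp_of_one_le {t : ℝ} (h : 1 ≤ t) : clamp t = 1 := by simp [clamp, h]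

theorem clamp_of_nonpos {t : ℝ} (h : t ≤ 0) : clamp t = 0 := by
  simp [clamp, h]

/-- The cut-off function which is `1` for `s ≤ 1 / (n + 1)` and `0` for `s ≥ 1 / n`. -/
noncomputable def cutoff (n : ℕ) (s : ℝ) : ℝ := clamp ((n + 1) * (1 - n * s))

@[fun_prop]
theorem continuous_cutoff (n : ℕ) : Continuous (cutoff n) := by unfold cutoff; fun_prop

theorem cutoff_nonneg (n : ℕ) (s : ℝ) : 0 ≤ cutoff n s := clamp_nonneg _

theorem cutoff_zero_left (s : ℝ) : cutoff 0 s = 1 := clamp_of_one_le (by simp)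

theorem cutoff_zero_right (n : ℕ) : cutoff n 0 = 1 := clamp_of_one_le (by simp)

theorem cutoff_succ_one (n : ℕ) : cutoff (n + 1) 1 = 0 :=
  clamp_of_nonpos (by push_cast; nlinarith [Nat.cast_nonneg (α := ℝ) n])

/-- `cutoff k` dies at `1 / k ≤ 1 / (n + 1)`, up to which `cutoff n` is still `1`. So at each time
`s > 0` the sequence of cutoffs consists of ones, at most one intermediate value, then zeros. -/
theorem cutoff_eq_one {n k : ℕ} {s : ℝ} (hs : 0 ≤ s) (hnk : n < k) (h : 0 < cutoff k s) :
    cutoff n s = 1 := by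
  have hk : (k : ℝ) * s < 1 := by
    by_contra! hc
    refine h.ne' (clamp_of_nonpos ?_)
    exact mul_nonpos_of_nonneg_of_nonpos (by positivity) (by linarith)
  have hnk' : (n : ℝ) + 1 ≤ k := by exact_mod_cast hnk
  have : ((n : ℝ) + 1) * s ≤ k * s := mul_le_mul_of_nonneg_right hnk' hs
  refine clamp_of_one_le ?_
  nlinarith [Nat.cast_nonneg (α := ℝ) n]

theorem cutoff_succ_le (n : ℕ) {s : ℝ} (hs : 0 ≤ s) : cutoff (n + 1) s ≤ cutoff n s := by
  rcases (cutoff_nonneg (n + 1) s).eq_or_lt with h | h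
  · rw [← h]; exact cutoff_nonneg n s
  · rw [cutoff_eq_one hs n.lt_succ_self h]; exact clamp_le_one _

/-- The part of the `m`-th coordinate which is moved to the `p`-th place at time `s` of a
deformation of the infinite join from the identity, at time `0`, to the map which moves the `m`-th
coordinate to the place `2 * m + d`. -/
noncomputable def spread (d m p : ℕ) (s : ℝ) : ℝ :=
  if p = m then cutoff (m + d) s
  else if m < p ∧ p ≤ 2 * m + d then
    cutoff (2 * m + d - p) s - cutoff (2 * m + d - p + 1) s
  else 0

@[fun_prop]
theorem continuous_spread (d m p : ℕ) : Continuous (spread d m p) := by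
  unfold spread; split_ifs <;> fun_prop

theorem spread_nonneg (d m p : ℕ) {s : ℝ} (hs : 0 ≤ s) : 0 ≤ spread d m p s := by
  unfold spread
  split_ifs
  · exact cutoff_nonneg _ _
  · exact sub_nonneg.2 (cutoff_succ_le _ hs)
  · exact le_rfl

theorem le_of_spread_pos {d m p : ℕ} {s : ℝ} (h : 0 < spread d m p s) : m ≤ p ∧ p ≤ 2 * m + d := by
  unfold spread at h
  split_ifs at h with h1 h2
  · omega
  · omega
  · exact absurd h (lt_irrefl _)

theorem eq_of_spread_zero_pos {d m p : ℕ} (h : 0 < spread d m p 0) : p = m := by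
  unfold spread at h
  split_ifs at h with h1 h2
  · exact h1
  · simp [cutoff_zero_right] at h
  · exact absurd h (lt_irrefl _)

theorem spread_zero (d m : ℕ) : spread d m m 0 = 1 := by simp [spread, cutoff_zero_right]

theorem eq_of_spread_one_pos {d m p : ℕ} (h : 0 < spread d m p 1) : p = 2 * m + d := by
  have key {n : ℕ} (h : 0 < cutoff n 1) : n = 0 := by
    cases n with
    | zero => rfl
    | succ n => exact absurd (cutoff_succ_one n) h.ne'
  unfold spread at h
  split_ifs at h with h1 h2
  · have := key h; omega
  · rw [cutoff_succ_one, sub_zero] at h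
    have := key h; omega
  · exact absurd h (lt_irrefl _)

theorem spread_sum (d m : ℕ) (s : ℝ) : ∑ p ∈ Finset.range (2 * m + d + 1), spread d m p s = 1 := by
  -- Sum over the remaining distance `j = 2 * m + d - p`: the terms with `j < m + d` telescope from
  -- `cutoff 0 = 1`, `j = m + d` is the starting place, and larger `j` contribute nothing.
  rw [← Finset.sum_range_reflect, show 2 * m + d + 1 = (m + d) + 1 + m by ring, Finset.sum_range_add,
    Finset.sum_range_succ]
  have h1 : ∑ j ∈ Finset.range (m + d), spread d m (m + d + 1 + m - 1 - j) s = 1 - cutoff (m + d) s := by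
    rw [← cutoff_zero_left s, ← Finset.sum_range_sub' (cutoff · s)]
    refine Finset.sum_congr rfl fun j hj => ?_
    have hj := Finset.mem_range.1 hj
    rw [spread, if_neg (by omega), if_pos (by omega)]
    congr 2 <;> omega
  have h2 : ∑ j ∈ Finset.range m, spread d m (m + d + 1 + m - 1 - (m + d + 1 + j)) s = 0 := by
    refine Finset.sum_eq_zero fun j hj => ?_
    have hj := Finset.mem_range.1 hj
    rw [spread, if_neg (by omega), if_neg (by omega)]
  rw [h1, h2, spread, if_pos (by omega)]
  ring

/-- During `[1 / (k + 1), 1 / k]` the coordinates with `m + d ≥ k` move from distance `k` to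
distance `k - 1` from their targets, while those of smaller index wait at their places. Neighbouring
moving coordinates are two places apart, so a step by one never causes a collision. -/
theorem spread_disjoint {d m m' p : ℕ} {s : ℝ} (hs : 0 ≤ s) (h : 0 < spread d m p s)
    (h' : 0 < spread d m' p s) : m = m' := by
  wlog hlt : m < m' generalizing m m'
  · rcases (not_lt.1 hlt).eq_or_lt with h1 | h1
    · exact h1.symm
    · exact (this h' h h1).symm
  have key {n k : ℕ} (hnk : n + 1 < k) (h : 0 < cutoff n s - cutoff (n + 1) s)
      (hk : 0 < cutoff k s) : False := by
    rw [cutoff_eq_one hs hnk hk, cutoff_eq_one hs (by omega) hk, sub_self] at h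
    exact lt_irrefl _ h
  have hp := le_of_spread_pos h
  have hp' := le_of_spread_pos h'
  rw [spread, if_neg (by omega), if_pos (by omega)] at h
  unfold spread at h'
  split_ifs at h' with h1 h2
  · exact (key (by omega) h h').elim
  · refine (key (by omega) h (lt_of_lt_of_le h' (sub_le_self _ (cutoff_nonneg _ _)))).elim
  · exact absurd h' (lt_irrefl _)

/-! ### The path between two points of the join. -/

namespace InfiniteJoin

variable {Z : Type*}

theorem ext {x y : InfiniteJoin Z} (hw : ∀ n, x.weight n = y.weight n)
    (hc : ∀ n (h : 0 < x.weight n) (h' : 0 < y.weight n), x.coord n h = y.coord n h') : x = y := by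
  obtain ⟨t, _, _, z⟩ := x
  obtain ⟨t', _, _, z'⟩ := y
  obtain rfl : t = t' := Finsupp.ext hw
  congr 1
  funext n h
  exact hc n h h

theorem exists_weight_pos (x : InfiniteJoin Z) : ∃ n, 0 < x.weight n := by
  by_contra! h
  have hx := x.weight_sum
  rw [Finsupp.sum, Finset.sum_eq_zero fun n _ => le_antisymm (h n) (x.weight_nonneg n)] at hx
  exact zero_ne_one hx

theorem exists_forall_sum_range_eq_one (x : InfiniteJoin Z) :
    ∃ N, (∀ n, N ≤ n → x.weight n = 0) ∧ ∀ n, N ≤ n → ∑ m ∈ Finset.range n, x.weight m = 1 := by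
  obtain ⟨N, hN⟩ := x.weight.support.exists_nat_subset_range
  have h0 (n : ℕ) (hn : N ≤ n) : x.weight n = 0 := by
    by_contra hc
    have := Finset.mem_range.1 (hN (Finsupp.mem_support_iff.2 hc))
    omega
  refine ⟨N, h0, fun n hn => ?_⟩
  rw [← x.weight_sum, Finsupp.sum]
  refine (Finset.sum_subset (hN.trans (Finset.range_mono hn)) fun m _ hm => ?_).symm
  exact Finsupp.notMem_support_iff.1 hm

/-- The total weight moved to the `p`-th place by `spread`. -/
noncomputable def spreadWeight (d : ℕ) (s : ℝ) (x : InfiniteJoin Z) (p : ℕ) : ℝ :=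
  ∑ m ∈ Finset.range (p + 1), spread d m p s * x.weight m

theorem spreadWeight_nonneg (d : ℕ) {s : ℝ} (hs : 0 ≤ s) (x : InfiniteJoin Z) (p : ℕ) :
    0 ≤ spreadWeight d s x p :=
  Finset.sum_nonneg fun m _ => mul_nonneg (spread_nonneg d m p hs) (x.weight_nonneg m)

theorem spreadWeight_pos_iff {d : ℕ} {s : ℝ} (hs : 0 ≤ s) {x : InfiniteJoin Z} {p : ℕ} :
    0 < spreadWeight d s x p ↔ ∃ m, 0 < spread d m p s ∧ 0 < x.weight m := by
  have h0 (m : ℕ) : 0 ≤ spread d m p s * x.weight m :=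
    mul_nonneg (spread_nonneg d m p hs) (x.weight_nonneg m)
  rw [spreadWeight, Finset.sum_pos_iff_of_nonneg fun m _ => h0 m]
  constructor
  · rintro ⟨m, -, hm⟩
    exact ⟨m, pos_of_mul_pos_left hm (x.weight_nonneg m),
      pos_of_mul_pos_right hm (spread_nonneg d m p hs)⟩
  · rintro ⟨m, h1, h2⟩
    exact ⟨m, Finset.mem_range.2 (by have := le_of_spread_pos h1; omega), mul_pos h1 h2⟩

theorem spreadWeight_zero (d : ℕ) (x : InfiniteJoin Z) (p : ℕ) :
    spreadWeight d 0 x p = x.weight p := by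
  rw [spreadWeight, Finset.sum_range_succ, Finset.sum_eq_zero, spread_zero, one_mul, zero_add]
  intro m hm
  have hm := Finset.mem_range.1 hm
  rw [(spread_nonneg d m p le_rfl).antisymm' (not_lt.1 fun h => ?_), zero_mul]
  have := eq_of_spread_zero_pos h
  omega

theorem exists_forall_spreadWeight (d : ℕ) {s : ℝ} (hs : 0 ≤ s) (x : InfiniteJoin Z) :
    ∃ N, (∀ n, N ≤ n → spreadWeight d s x n = 0) ∧
      ∀ n, N ≤ n → ∑ p ∈ Finset.range n, spreadWeight d s x p = 1 := by
  have hz {m p : ℕ} (h : ¬(m ≤ p ∧ p ≤ 2 * m + d)) : spread d m p s = 0 :=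
    (spread_nonneg d m p hs).antisymm' (not_lt.1 fun h' => h (le_of_spread_pos h'))
  obtain ⟨N, h0, h1⟩ := x.exists_forall_sum_range_eq_one
  -- Only indices `m < N` carry weight, and they travel no further than `2 * m + d`.
  refine ⟨2 * N + d + 1, fun n hn => Finset.sum_eq_zero fun m hm => ?_, fun n hn => ?_⟩
  · by_cases hm : N ≤ m
    · rw [h0 m hm, mul_zero]
    · rw [hz (by omega), zero_mul]
  · rw [← h1 n (by omega)]
    have : ∀ p ∈ Finset.range n, spreadWeight d s x p =
        ∑ m ∈ Finset.range n, spread d m p s * x.weight m := by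
      intro p hp
      have hp := Finset.mem_range.1 hp
      refine Finset.sum_subset (Finset.range_mono (by omega)) fun m _ hm => ?_
      rw [Finset.mem_range] at hm
      rw [hz (by omega), zero_mul]
    rw [Finset.sum_congr rfl this, Finset.sum_comm]
    refine Finset.sum_congr rfl fun m _ => ?_
    by_cases hm : N ≤ m
    · simp [h0 m hm]
    · rw [← Finset.sum_mul]
      convert one_mul _
      rw [← spread_sum d m s]
      refine (Finset.sum_subset (Finset.range_mono (by omega)) fun p _ hp => ?_).symm
      rw [Finset.mem_range] at hp
      exact hz (by omega)

/-- The point `z` is a coordinate of `x` which is moved to the `p`-th place by `spread`. -/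
def IsSpreadCoord (d : ℕ) (s : ℝ) (x : InfiniteJoin Z) (p : ℕ) (z : Z) : Prop :=
  ∃ m, 0 < spread d m p s ∧ ∃ h : 0 < x.weight m, x.coord m h = z

theorem IsSpreadCoord.unique {d : ℕ} {s : ℝ} (hs : 0 ≤ s) {x : InfiniteJoin Z} {p : ℕ} {z z' : Z}
    (h : IsSpreadCoord d s x p z) (h' : IsSpreadCoord d s x p z') : z = z' := by
  obtain ⟨m, h1, h2, rfl⟩ := h
  obtain ⟨m', h1', h2', rfl⟩ := h'
  obtain rfl := spread_disjoint hs h1 h1'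
  rfl

theorem exists_isSpreadCoord {d : ℕ} {s : ℝ} (hs : 0 ≤ s) {x : InfiniteJoin Z} {p : ℕ}
    (h : 0 < spreadWeight d s x p) : ∃ z, IsSpreadCoord d s x p z := by
  obtain ⟨m, h1, h2⟩ := (spreadWeight_pos_iff hs).1 h
  exact ⟨_, m, h1, h2, rfl⟩

/-- The weight of the first point in `mix`. -/
noncomputable def mixRatio (s : ℝ) : ℝ := clamp (2 - 3 * s)

/-- The point `z` is the `p`-th coordinate of the mixture of `x` and `y` at time `s`. -/
def IsMixCoord (s : ℝ) (x y : InfiniteJoin Z) (p : ℕ) (z : Z) : Prop :=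
  (0 < mixRatio s ∧ IsSpreadCoord 0 (clamp (3 * s)) x p z) ∨
    (0 < 1 - mixRatio s ∧ IsSpreadCoord 1 (clamp (3 - 3 * s)) y p z)

/-- The `p`-th weight of the mixture of `x` and `y` at time `s`. -/
noncomputable def mixWeight (s : ℝ) (x y : InfiniteJoin Z) (p : ℕ) : ℝ :=
  mixRatio s * spreadWeight 0 (clamp (3 * s)) x p +
    (1 - mixRatio s) * spreadWeight 1 (clamp (3 - 3 * s)) y p

/-- This lets `mix` choose a coordinate at exactly the places of positive weight. -/
theorem mixWeight_pos_iff {s : ℝ} {x y : InfiniteJoin Z} {p : ℕ} :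
    0 < mixWeight s x y p ↔ ∃ z, IsMixCoord s x y p z := by
  have h1 : 0 ≤ mixRatio s := clamp_nonneg _
  have h2 : 0 ≤ 1 - mixRatio s := sub_nonneg.2 (clamp_le_one _)
  have h3 := spreadWeight_nonneg 0 (clamp_nonneg (3 * s)) x p
  have h4 := spreadWeight_nonneg 1 (clamp_nonneg (3 - 3 * s)) y p
  constructor
  · intro h
    have : 0 < mixRatio s * spreadWeight 0 (clamp (3 * s)) x p ∨
        0 < (1 - mixRatio s) * spreadWeight 1 (clamp (3 - 3 * s)) y p := by
      by_contra! hc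
      exact h.not_ge (add_nonpos hc.1 hc.2)
    rcases this with h | h
    · obtain ⟨z, hz⟩ := exists_isSpreadCoord (clamp_nonneg _) (pos_of_mul_pos_right h h1)
      exact ⟨z, .inl ⟨pos_of_mul_pos_left h h3, hz⟩⟩
    · obtain ⟨z, hz⟩ := exists_isSpreadCoord (clamp_nonneg _) (pos_of_mul_pos_right h h2)
      exact ⟨z, .inr ⟨pos_of_mul_pos_left h h4, hz⟩⟩
  · rintro ⟨z, ⟨h, m, hm, hx, -⟩ | ⟨h, m, hm, hy, -⟩⟩
    · exact add_pos_of_pos_of_nonneg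
        (mul_pos h ((spreadWeight_pos_iff (clamp_nonneg _)).2 ⟨m, hm, hx⟩)) (mul_nonneg h2 h4)
    · exact add_pos_of_nonneg_of_pos (mul_nonneg h1 h3)
        (mul_pos h ((spreadWeight_pos_iff (clamp_nonneg _)).2 ⟨m, hm, hy⟩))

/-- Both points contribute only in the middle third of the time, when the coordinates of `x` sit at
even places and those of `y` at odd ones. Otherwise a single point contributes and `spread_disjoint`
applies. -/
theorem IsMixCoord.unique {s : ℝ} {x y : InfiniteJoin Z} {p : ℕ} {z z' : Z}
    (h : IsMixCoord s x y p z) (h' : IsMixCoord s x y p z') : z = z' := by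
  have key {z z' : Z} (h1 : 0 < mixRatio s) (h2 : 0 < 1 - mixRatio s)
      (h3 : IsSpreadCoord 0 (clamp (3 * s)) x p z)
      (h4 : IsSpreadCoord 1 (clamp (3 - 3 * s)) y p z') : False := by
    have h5 : 1 ≤ 3 * s := by
      by_contra! hc
      rw [mixRatio, clamp_of_one_le (by linarith), sub_self] at h2
      exact lt_irrefl _ h2
    have h6 : 1 ≤ 3 - 3 * s := by
      by_contra! hc
      rw [mixRatio, clamp_of_nonpos (by linarith)] at h1
      exact lt_irrefl _ h1
    rw [clamp_of_one_le h5] at h3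
    rw [clamp_of_one_le h6] at h4
    obtain ⟨m, hm, -⟩ := h3
    obtain ⟨m', hm', -⟩ := h4
    have := eq_of_spread_one_pos hm
    have := eq_of_spread_one_pos hm'
    omega
  rcases h with ⟨h1, h2⟩ | ⟨h1, h2⟩ <;> rcases h' with ⟨h3, h4⟩ | ⟨h3, h4⟩
  · exact h2.unique (clamp_nonneg _) h4
  · exact (key h1 h3 h2 h4).elim
  · exact (key h3 h1 h4 h2).elim
  · exact h2.unique (clamp_nonneg _) h4

theorem exists_forall_mixWeight (s : ℝ) (x y : InfiniteJoin Z) :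
    ∃ N, (∀ n, N ≤ n → mixWeight s x y n = 0) ∧
      ∀ n, N ≤ n → ∑ p ∈ Finset.range n, mixWeight s x y p = 1 := by
  obtain ⟨N, h0, h1⟩ := exists_forall_spreadWeight 0 (clamp_nonneg (3 * s)) x
  obtain ⟨N', h0', h1'⟩ := exists_forall_spreadWeight 1 (clamp_nonneg (3 - 3 * s)) y
  refine ⟨max N N', fun n hn => ?_, fun n hn => ?_⟩
  · rw [mixWeight, h0 n (le_of_max_le_left hn), h0' n (le_of_max_le_right hn)]
    ring
  · simp only [mixWeight]
    rw [Finset.sum_add_distrib, ← Finset.mul_sum, ← Finset.mul_sum, h1 n (le_of_max_le_left hn),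
      h1' n (le_of_max_le_right hn)]
    ring

theorem mixWeight_nonneg (s : ℝ) (x y : InfiniteJoin Z) (p : ℕ) : 0 ≤ mixWeight s x y p :=
  add_nonneg (mul_nonneg (clamp_nonneg _) (spreadWeight_nonneg _ (clamp_nonneg _) _ _))
    (mul_nonneg (sub_nonneg.2 (clamp_le_one _)) (spreadWeight_nonneg _ (clamp_nonneg _) _ _))

/-- The path from `x` to `y` which first moves the coordinates of `x` to the even places, then
interpolates to the point with the coordinates of `y` in the odd places, and finally moves these
back. -/
noncomputable def mix (s : ℝ) (x y : InfiniteJoin Z) : InfiniteJoin Z where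
  weight := Finsupp.onFinset (Finset.range (exists_forall_mixWeight s x y).choose)
    (mixWeight s x y) fun n hn => Finset.mem_range.2 <| not_le.1 fun h =>
      hn ((exists_forall_mixWeight s x y).choose_spec.1 n h)
  weight_nonneg := mixWeight_nonneg s x y
  weight_sum := by
    rw [Finsupp.onFinset_sum _ fun _ => rfl]
    exact (exists_forall_mixWeight s x y).choose_spec.2 _ le_rfl
  coord n h := (mixWeight_pos_iff.1 h).choose

theorem mix_coord_eq {s : ℝ} {x y : InfiniteJoin Z} {p : ℕ} {z : Z} (hz : IsMixCoord s x y p z)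
    (h : 0 < (mix s x y).weight p) : (mix s x y).coord p h = z :=
  (mixWeight_pos_iff.1 h).choose_spec.unique hz

theorem mix_zero (x y : InfiniteJoin Z) : mix 0 x y = x := by
  have h : mixRatio 0 = 1 := clamp_of_one_le (by norm_num)
  have h' : clamp (3 * 0) = 0 := clamp_of_nonpos (by norm_num)
  refine ext (fun n => ?_) fun n h1 h2 => mix_coord_eq (.inl ⟨by simp [h], n, ?_, h2, rfl⟩) h1
  · change mixWeight 0 x y n = _
    rw [mixWeight, h, h', spreadWeight_zero]
    ring
  · rw [h', spread_zero]
    exact one_pos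

theorem mix_one (x y : InfiniteJoin Z) : mix 1 x y = y := by
  have h : mixRatio 1 = 0 := clamp_of_nonpos (by norm_num)
  have h' : clamp (3 - 3 * 1) = 0 := clamp_of_nonpos (by norm_num)
  refine ext (fun n => ?_) fun n h1 h2 => mix_coord_eq (.inr ⟨by simp [h], n, ?_, h2, rfl⟩) h1
  · change mixWeight 1 x y n = _
    rw [mixWeight, h, h', spreadWeight_zero]
    ring
  · rw [h', spread_zero]
    exact one_pos

theorem mix_smul {G : Type*} [Group G] [MulAction G Z] (s : ℝ) (g : G) (x y : InfiniteJoin Z) :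
    mix s (g • x) (g • y) = g • mix s x y := by
  refine ext (fun n => rfl) fun n h1 h2 => ?_
  obtain ⟨z, hz⟩ := mixWeight_pos_iff.1 h2
  change _ = g • (mix s x y).coord n h2
  rw [mix_coord_eq hz]
  refine mix_coord_eq ?_ h1
  rcases hz with ⟨h, m, hm, hx, rfl⟩ | ⟨h, m, hm, hy, rfl⟩
  · exact .inl ⟨h, m, hm, hx, rfl⟩
  · exact .inr ⟨h, m, hm, hy, rfl⟩

variable [TopologicalSpace Z]

@[fun_prop]
theorem continuous_spreadWeight (d p : ℕ) :
    Continuous fun q : ℝ × InfiniteJoin Z => spreadWeight d q.1 q.2 p := by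
  unfold spreadWeight
  refine continuous_finsetSum _ fun m _ => ?_
  exact ((continuous_spread d m p).comp continuous_fst).mul
    ((continuous_weight m).comp continuous_snd)

/-- The condition is a union of open rectangles, one for each source index `m`. -/
theorem isOpen_isSpreadCoord (d p : ℕ) {V : Set Z} (hV : IsOpen V) :
    IsOpen {q : ℝ × InfiniteJoin Z | ∃ z ∈ V, IsSpreadCoord d q.1 q.2 p z} := by
  have : {q : ℝ × InfiniteJoin Z | ∃ z ∈ V, IsSpreadCoord d q.1 q.2 p z} =
      ⋃ m, {s | 0 < spread d m p s} ×ˢ {x | ∃ h : 0 < x.weight m, x.coord m h ∈ V} := by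
    ext ⟨s, x⟩
    simp only [mem_ofPred_eq, mem_iUnion, mem_prod]
    constructor
    · rintro ⟨z, hz, m, hm, hx, rfl⟩
      exact ⟨m, hm, hx, hz⟩
    · rintro ⟨m, hm, hx, hz⟩
      exact ⟨_, hz, m, hm, hx, rfl⟩
  rw [this]
  exact isOpen_iUnion fun m =>
    (isOpen_lt continuous_const (continuous_spread d m p)).prod (isOpen_coord m hV)

theorem continuous_mix :
    Continuous fun q : ℝ × InfiniteJoin Z × InfiniteJoin Z => mix q.1 q.2.1 q.2.2 := by
  have hr : Continuous fun q : ℝ × InfiniteJoin Z × InfiniteJoin Z => mixRatio q.1 := by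
    unfold mixRatio; fun_prop
  have h1 : Continuous fun q : ℝ × InfiniteJoin Z × InfiniteJoin Z =>
      (clamp (3 * q.1), q.2.1) := by fun_prop
  have h2 : Continuous fun q : ℝ × InfiniteJoin Z × InfiniteJoin Z =>
      (clamp (3 - 3 * q.1), q.2.2) := by fun_prop
  refine continuous_generateFrom_iff.2 ?_
  rintro s (⟨n, V, hV, rfl⟩ | ⟨n, V, hV, rfl⟩)
  · refine hV.preimage (?_ : Continuous fun q : ℝ × InfiniteJoin Z × InfiniteJoin Z =>
      mixWeight q.1 q.2.1 q.2.2 n)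
    have e1 := (continuous_spreadWeight 0 n).comp h1
    have e2 := (continuous_spreadWeight 1 n).comp h2
    exact (hr.mul e1).add ((continuous_const.sub hr).mul e2)
  · have hA : IsOpen {q : ℝ × InfiniteJoin Z × InfiniteJoin Z | 0 < mixRatio q.1} :=
      isOpen_lt continuous_const hr
    have hB : IsOpen {q : ℝ × InfiniteJoin Z × InfiniteJoin Z | 0 < 1 - mixRatio q.1} :=
      isOpen_lt continuous_const (continuous_const.sub hr)
    have hC := (isOpen_isSpreadCoord 0 n hV).preimage h1
    have hD := (isOpen_isSpreadCoord 1 n hV).preimage h2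
    -- By uniqueness the chosen coordinate lies in `V` exactly when some coordinate contributed by
    -- `x` or by `y` does.
    refine (congrArg IsOpen ?_).mpr ((hA.inter hC).union (hB.inter hD))
    ext ⟨s, x, y⟩
    constructor
    · rintro ⟨h, hz⟩
      obtain ⟨z, hm⟩ := mixWeight_pos_iff.1 h
      rw [mix_coord_eq hm] at hz
      rcases hm with ⟨h, hm⟩ | ⟨h, hm⟩
      · exact .inl ⟨h, z, hz, hm⟩
      · exact .inr ⟨h, z, hz, hm⟩
    · rintro (⟨h, z, hz, hm⟩ | ⟨h, z, hz, hm⟩)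
      · have hm : IsMixCoord s x y n z := .inl ⟨h, hm⟩
        exact ⟨mixWeight_pos_iff.2 ⟨z, hm⟩, (mix_coord_eq hm _).symm ▸ hz⟩
      · have hm : IsMixCoord s x y n z := .inr ⟨h, hm⟩
        exact ⟨mixWeight_pos_iff.2 ⟨z, hm⟩, (mix_coord_eq hm _).symm ▸ hz⟩

theorem gHomotopic_pr (G : Type*) [Group G] [MulAction G Z] :
    GHomotopic (GMap.pr₁ G (InfiniteJoin Z)) (GMap.pr₂ G (InfiniteJoin Z)) := by
  refine ⟨⟨⟨fun p => mix p.1 p.2.1 p.2.2, ?_⟩, fun q => ?_, fun q => ?_⟩,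
    fun t g q => mix_smul t g q.1 q.2⟩
  rotate_left
  · change mix ((0 : unitInterval) : ℝ) q.1 q.2 = q.1
    rw [Icc.coe_zero, mix_zero]
  · change mix ((1 : unitInterval) : ℝ) q.1 q.2 = q.2
    rw [Icc.coe_one, mix_one]
  have h : Continuous fun p : unitInterval × InfiniteJoin Z × InfiniteJoin Z => ((p.1 : ℝ), p.2) := by
    fun_prop
  have h' := continuous_mix.comp h
  exact h'

end InfiniteJoin


/-! ### Partitions of unity on the join. -/

/-- A locally finite family of nonnegative functions without a common zero can be normalized to a
partition of unity. -/
theorem exists_partitionOfUnity_eq_div {I X : Type*} [TopologicalSpace X] (r : I → C(X, ℝ))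
    (h0 : ∀ i x, 0 ≤ r i x) (hpos : ∀ x, ∃ i, 0 < r i x)
    (hr : LocallyFinite fun i => Function.support (r i)) :
    ∃ e : PartitionOfUnity I X, ∀ i x, e i x = r i x / ∑ᶠ j, r j x := by
  have hS : ∀ x, 0 < ∑ᶠ j, r j x := fun x =>
    finsum_pos (fun i => h0 i x) (hpos x) (hr.point_finite x)
  have hc : Continuous fun x => ∑ᶠ j, r j x := continuous_finsum (fun i => (r i).continuous) hr
  have h1 (x : X) : ∑ᶠ i, r i x / ∑ᶠ j, r j x = 1 := by
    simp only [div_eq_mul_inv]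
    rw [← finsum_mul, mul_inv_cancel₀ (hS x).ne']
  exact ⟨{
    toFun := fun i => ⟨fun x => r i x / ∑ᶠ j, r j x,
      (r i).continuous.div hc fun x => (hS x).ne'⟩
    locallyFinite' := hr.subset fun i x hx hc => hx (by simp [hc])
    nonneg' := fun i x => div_nonneg (h0 i x) (hS x).le
    sum_eq_one' := fun x _ => h1 x
    sum_le_one' := fun x => (h1 x).le }, fun i x => rfl⟩

/-- A partition of unity can be refined along decompositions of the members of a covering to which
it is subordinate into disjoint open sets. -/
theorem exists_partitionOfUnity_sigma {I J X : Type*} [TopologicalSpace X]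
    (e : PartitionOfUnity I X) (V : I → J → Set X) (hV : ∀ i j, IsOpen (V i j))
    (hd : ∀ i j j' x, x ∈ V i j → x ∈ V i j' → j = j')
    (he : e.IsSubordinate fun i => ⋃ j, V i j) :
    ∃ e' : PartitionOfUnity (I × J) X, (e'.IsSubordinate fun p => V p.1 p.2) ∧
      ∀ p x, e' p x = (V p.1 p.2).indicator (e p.1) x := by
  classical
  have hloc (i : I) (x : X) (hx : x ∈ tsupport (e i)) : ∃ j, x ∈ V i j := mem_iUnion.1 (he i hx)
  have hout (i : I) (x : X) (hx : x ∉ tsupport (e i)) : ∀ᶠ y in 𝓝 x, e i y = 0 :=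
    notMem_tsupport_iff_eventuallyEq.1 hx
  have hc (p : I × J) : Continuous ((V p.1 p.2).indicator (e p.1)) := by
    refine continuous_iff_continuousAt.2 fun x => ?_
    -- On the closed support some `V p.1 j` is a neighbourhood on which the indicator is either `e
    -- p.1` or `0`; elsewhere `e p.1` vanishes nearby.
    by_cases hx : x ∈ tsupport (e p.1)
    · obtain ⟨j, hj⟩ := hloc p.1 x hx
      by_cases hjp : j = p.2
      · refine (e p.1).continuous.continuousAt.congr ?_
        filter_upwards [(hV p.1 j).mem_nhds hj] with y hy
        rw [indicator_of_mem (hjp ▸ hy)]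
      · refine (continuousAt_const (y := (0 : ℝ))).congr ?_
        filter_upwards [(hV p.1 j).mem_nhds hj] with y hy
        rw [indicator_of_notMem fun hy' => hjp (hd _ _ _ y hy hy')]
    · refine (continuousAt_const (y := (0 : ℝ))).congr ?_
      filter_upwards [hout p.1 x hx] with y hy
      simp [indicator_apply, hy]
  have hsum (i : I) (x : X) : ∑ᶠ j, (V i j).indicator (e i) x = e i x := by
    by_cases hx : x ∈ tsupport (e i)
    · obtain ⟨j, hj⟩ := hloc i x hx
      rw [finsum_eq_single _ j fun j' hj' =>
        indicator_of_notMem (fun h => hj' (hd i _ _ x h hj)) _, indicator_of_mem hj]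
    · have hz : e i x = 0 := image_eq_zero_of_notMem_tsupport hx
      simp [indicator_apply, hz]
  have hlf : LocallyFinite fun p : I × J => Function.support ((V p.1 p.2).indicator (e p.1)) := by
    intro x
    obtain ⟨S, hS⟩ := e.exists_finset_nhds x
    -- Near `x` each `i` admits at most one `j`, and only the finitely many `i ∈ S` matter.
    have hW (i : I) : ∃ W ∈ 𝓝 x,
        {j | (Function.support ((V i j).indicator (e i)) ∩ W).Nonempty}.Finite := by
      by_cases hx : x ∈ tsupport (e i)
      · obtain ⟨j, hj⟩ := hloc i x hx
        refine ⟨V i j, (hV i j).mem_nhds hj, (finite_singleton j).subset ?_⟩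
        rintro j' ⟨y, hy, hy'⟩
        exact hd i _ _ y (mem_of_indicator_ne_zero hy) hy'
      · refine ⟨_, hout i x hx, finite_empty.subset ?_⟩
        rintro j' ⟨y, hy, hy'⟩
        exact hy (by simp [indicator_apply, show e i y = 0 from hy'])
    choose W hW hW' using hW
    refine ⟨_, Filter.inter_mem ((Filter.biInter_finset_mem S).2 fun i _ => hW i) hS, ?_⟩
    refine (S.finite_toSet.biUnion fun i _ => ((hW' i).image (Prod.mk i))).subset ?_
    rintro ⟨i, j⟩ ⟨y, hy, hy', hyS⟩
    have hi : i ∈ S := hyS.2 fun h => hy (by simp [indicator_apply, h])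
    exact mem_biUnion hi ⟨j, ⟨y, hy, mem_iInter₂.1 hy' i hi⟩, rfl⟩
  have hsum' (x : X) : ∑ᶠ p : I × J, (V p.1 p.2).indicator (e p.1) x = 1 := by
    rw [finsum_curry _ (hlf.point_finite x)]
    simp only [hsum]
    exact e.sum_eq_one (mem_univ x)
  refine ⟨{
    toFun := fun p => ⟨_, hc p⟩
    locallyFinite' := hlf
    nonneg' := fun p x => indicator_nonneg (fun y _ => e.nonneg _ y) x
    sum_eq_one' := fun x _ => hsum' x
    sum_le_one' := fun x => (hsum' x).le }, fun p x hx => ?_, fun _ _ => rfl⟩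
  have hx' : x ∈ tsupport ((V p.1 p.2).indicator (e p.1)) := hx
  have hxe : x ∈ tsupport (e p.1) := by
    refine closure_mono (fun y hy h => ?_) hx'
    exact hy (by simp [indicator_apply, h])
  obtain ⟨j, hj⟩ := hloc p.1 x hxe
  obtain ⟨y, hy, hy'⟩ := mem_closure_iff.1 hx' _ (hV p.1 j) hj
  obtain rfl := hd _ _ _ y hy (mem_of_indicator_ne_zero hy')
  exact hj

namespace InfiniteJoin

variable {Z : Type*}

/-- The excess of the weight `tₙ` over `n` times the sum of the preceding weights. -/
noncomputable def excess (n : ℕ) (x : InfiniteJoin Z) : ℝ :=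
  max 0 (x.weight n - n * ∑ i ∈ Finset.range n, x.weight i)

theorem excess_nonneg (n : ℕ) (x : InfiniteJoin Z) : 0 ≤ excess n x := le_max_left _ _

theorem excess_le (n : ℕ) (x : InfiniteJoin Z) : excess n x ≤ x.weight n :=
  max_le (x.weight_nonneg n) (sub_le_self _ (mul_nonneg n.cast_nonneg
    (Finset.sum_nonneg fun i _ => x.weight_nonneg i)))

theorem weight_le_one (n : ℕ) (x : InfiniteJoin Z) : x.weight n ≤ 1 := by
  obtain ⟨N, -, hN⟩ := x.exists_forall_sum_range_eq_one
  rw [← hN (max N (n + 1)) (le_max_left _ _)]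
  exact Finset.single_le_sum (f := fun i => x.weight i) (fun i _ => x.weight_nonneg i)
    (Finset.mem_range.2 (lt_of_lt_of_le n.lt_succ_self (le_max_right _ _)))

/-- At the first index of positive weight the preceding sum is zero, so the excess is the weight
itself. -/
theorem exists_excess_pos (x : InfiniteJoin Z) : ∃ n, 0 < excess n x := by
  classical
  have h := x.exists_weight_pos
  refine ⟨Nat.find h, ?_⟩
  rw [excess, Finset.sum_eq_zero fun i hi => ?_, mul_zero, sub_zero]
  · exact lt_max_of_lt_right (Nat.find_spec h)
  · exact le_antisymm (not_lt.1 (Nat.find_min h (Finset.mem_range.1 hi))) (x.weight_nonneg i)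

variable [TopologicalSpace Z]

theorem continuous_excess (n : ℕ) : Continuous (excess n : InfiniteJoin Z → ℝ) := by
  unfold excess
  exact continuous_const.max ((continuous_weight n).sub
    (continuous_const.mul (continuous_finsetSum _ fun i _ => continuous_weight i)))

/-- Where `t_k` stays above half its positive value at `x`, for all large `n` the product of `n`
with the preceding sum is at least `1`, which no weight exceeds. -/
theorem locallyFinite_support_excess :
    LocallyFinite fun n => Function.support (excess n : InfiniteJoin Z → ℝ) := by
  intro x
  obtain ⟨k, hk⟩ := x.exists_weight_pos
  obtain ⟨N, hN⟩ := exists_nat_gt (1 / (x.weight k / 2))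
  refine ⟨{y | x.weight k / 2 < y.weight k},
    (isOpen_lt continuous_const (continuous_weight k)).mem_nhds (half_lt_self hk),
    (Finset.range (max N (k + 1))).finite_toSet.subset ?_⟩
  rintro n ⟨y, hy, hyk⟩
  change x.weight k / 2 < y.weight k at hyk
  by_contra hn
  have hn : N ≤ n ∧ k < n := by simpa [Nat.succ_le_iff] using hn
  refine hy (max_eq_left (sub_nonpos.2 ((y.weight_le_one n).trans ?_)))
  have h1 : y.weight k ≤ ∑ i ∈ Finset.range n, y.weight i :=
    Finset.single_le_sum (f := fun i => y.weight i) (fun i _ => y.weight_nonneg i)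
      (Finset.mem_range.2 hn.2)
  have h2 : (N : ℝ) ≤ n := by exact_mod_cast hn.1
  have h3 : 1 < N * (x.weight k / 2) := (div_lt_iff₀ (half_pos hk)).1 hN
  calc (1 : ℝ) ≤ N * (x.weight k / 2) := h3.le
    _ ≤ n * (x.weight k / 2) := mul_le_mul_of_nonneg_right h2 (half_pos hk).le
    _ ≤ n * ∑ i ∈ Finset.range n, y.weight i :=
      mul_le_mul_of_nonneg_left (hyk.le.trans h1) n.cast_nonneg

/-- The support of `excess n` lies in `{0 < tₙ}`, but its closure need not. Subtracting the
threshold `S / 4 * (1 / 2) ^ n` forces the closed support into `{S / 4 * (1 / 2) ^ n ≤ tₙ}`. The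
thresholds add up to at most `S / 2 < S`, so the reduced functions have no common zero. Depending on
the weights alone, they are invariant under any action on the coordinates. -/
theorem exists_partitionOfUnity (Z : Type*) [TopologicalSpace Z] :
    ∃ e : PartitionOfUnity ℕ (InfiniteJoin Z),
      (e.IsSubordinate fun n => {x | 0 < x.weight n}) ∧
      ∀ n (x y : InfiniteJoin Z), x.weight = y.weight → e n x = e n y := by
  let S (x : InfiniteJoin Z) : ℝ := ∑ᶠ n, excess n x
  have hS : Continuous S := continuous_finsum continuous_excess locallyFinite_support_excess
  have hfin (x : InfiniteJoin Z) := locallyFinite_support_excess.point_finite x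
  have hpos (x : InfiniteJoin Z) : 0 < S x :=
    finsum_pos (fun n => excess_nonneg n x) x.exists_excess_pos (hfin x)
  let r (n : ℕ) : C(InfiniteJoin Z, ℝ) :=
    ⟨fun x => max 0 (excess n x - S x / 4 * (1 / 2) ^ n),
      continuous_const.max ((continuous_excess n).sub
        ((hS.div_const 4).mul continuous_const))⟩
  have hr0 (n : ℕ) (x : InfiniteJoin Z) : 0 ≤ r n x := le_max_left _ _
  have hrpos (x : InfiniteJoin Z) : ∃ n, 0 < r n x := by
    by_contra! hc
    have h1 (n : ℕ) : excess n x ≤ S x / 4 * (1 / 2) ^ n :=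
      sub_nonpos.1 ((le_max_right _ _).trans (hc n))
    obtain ⟨N, hN⟩ := (hfin x).toFinset.exists_nat_subset_range
    have h2 : S x = ∑ n ∈ Finset.range N, excess n x :=
      finsum_eq_sum_of_support_subset _ fun n hn => hN ((hfin x).mem_toFinset.2 hn)
    have h3 : S x ≤ S x / 4 * 2 := by
      nth_rewrite 1 [h2]
      refine (Finset.sum_le_sum fun n _ => h1 n).trans ?_
      rw [← Finset.mul_sum]
      exact mul_le_mul_of_nonneg_left (sum_geometric_two_le N) (by linarith [hpos x])
    linarith [hpos x]
  have hrs (n : ℕ) (x : InfiniteJoin Z) (h : r n x ≠ 0) :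
      S x / 4 * (1 / 2) ^ n < excess n x := by
    by_contra! hc
    exact h (max_eq_left (sub_nonpos.2 hc))
  have hlf : LocallyFinite fun n => Function.support (r n) :=
    locallyFinite_support_excess.subset fun n x hx =>
      ((mul_nonneg (by linarith [hpos x]) (by positivity)).trans_lt (hrs n x hx)).ne'
  obtain ⟨e, he⟩ := exists_partitionOfUnity_eq_div r hr0 hrpos hlf
  refine ⟨e, fun n => ?_, fun n x y hxy => ?_⟩
  · have hcl : IsClosed {x : InfiniteJoin Z | S x / 4 * (1 / 2) ^ n ≤ x.weight n} :=
      isClosed_le ((hS.div_const 4).mul continuous_const) (continuous_weight n)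
    refine (closure_minimal (fun x hx => ?_) hcl).trans fun x hx => ?_
    · refine (hrs n x fun h => hx ?_).le.trans (excess_le n x)
      rw [he, h, zero_div]
    · have h4 : 0 < S x / 4 := by linarith [hpos x]
      exact (mul_pos h4 (by positivity)).trans_le hx
  · have hex (n : ℕ) : excess n x = excess n y := by rw [excess, excess, hxy]
    have hS' : S x = S y := finsum_congr hex
    have hrxy (n : ℕ) : r n x = r n y := by
      change max 0 _ = max 0 _
      rw [hex, hS']
    rw [he, he, hrxy, finsum_congr hrxy]

end InfiniteJoin

/-! ### Numerability and isotropy groups of the join. -/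

theorem isNumerable_infiniteJoin {G : Type*} [Group G] [TopologicalSpace G]
    (F : SubgroupFamily G) : IsNumerable F (InfiniteJoin (OrbitSum F)) := by
  classical
  obtain ⟨e, he, heG⟩ := InfiniteJoin.exists_partitionOfUnity (OrbitSum F)
  let j (H : {H : Subgroup G // H ∈ F}) : G ⧸ H.1 → OrbitSum F := fun q => ⟨H, q⟩
  have hj (H) : IsOpenEmbedding (j H) :=
    .sigmaMk (σ := fun H : {H : Subgroup G // H ∈ F} => G ⧸ H.1)
  -- Each set of the cover must map to a single orbit, so `{0 < tₙ}` is cut up by the summand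
  -- containing `zₙ`; on `V n H` that coordinate is itself the `G`-map.
  let V (n : ℕ) (H : {H : Subgroup G // H ∈ F}) : Set (InfiniteJoin (OrbitSum F)) :=
    {x | ∃ h : 0 < x.weight n, x.coord n h ∈ range (j H)}
  have hV (n H) : IsOpen (V n H) := InfiniteJoin.isOpen_coord n (hj H).isOpen_range
  have hVd (n H H' x) (h : x ∈ V n H) (h' : x ∈ V n H') : H = H' := by
    obtain ⟨h, q, hq⟩ := h
    obtain ⟨_, q', hq'⟩ := h'
    exact congrArg Sigma.fst (hq.trans hq'.symm)
  have hVG (n H) (g : G) (x) (hx : x ∈ V n H) : g • x ∈ V n H := by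
    obtain ⟨h, q, hq⟩ := hx
    exact ⟨h, g • q, congrArg (g • ·) hq⟩
  have hVG' (n H) (g : G) (x) : g • x ∈ V n H ↔ x ∈ V n H :=
    ⟨fun h => by simpa using hVG n H g⁻¹ _ h, hVG n H g x⟩
  have heV : e.IsSubordinate fun n => ⋃ H, V n H := fun n x hx =>
    have h : 0 < x.weight n := he n hx
    mem_iUnion.2 ⟨(x.coord n h).1, h, (x.coord n h).2, rfl⟩
  obtain ⟨e', he', heq⟩ := exists_partitionOfUnity_sigma e V hV hVd heV
  refine ⟨ℕ × {H : Subgroup G // H ∈ F}, fun p => ⟨V p.1 p.2, fun g x hx => hVG _ _ g x hx⟩, e',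
    fun p => hV p.1 p.2, eq_univ_of_forall fun x => ?_, fun ⟨n, H⟩ => ⟨H.1, H.2, ?_⟩, he',
    fun p g x => ?_⟩
  · obtain ⟨p, hp⟩ := e'.exists_pos (mem_univ x)
    exact mem_iUnion.2 ⟨p, he' p (subset_tsupport _ hp.ne')⟩
  · choose hw q hq using fun x : V n H => x.2
    refine ⟨⟨⟨q, ⟨fun W hW => ?_⟩⟩, fun g x => (hj H).injective ?_⟩⟩
    · convert (InfiniteJoin.isOpen_coord n ((hj H).isOpenMap W hW)).preimage
        continuous_subtype_val using 1
      ext x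
      constructor
      · exact fun hx => ⟨hw x, q x, hx, hq x⟩
      · rintro ⟨h, q', hq', hx⟩
        have : q x = q' := (hj H).injective ((hq x).trans hx.symm)
        exact (congrArg (· ∈ W) this).mpr hq'
    · exact (hq _).trans (congrArg (g • ·) (hq x)).symm
  · rw [heq, heq, indicator_apply, indicator_apply, heG p.1 (g • x) x rfl]
    exact if_congr (hVG' _ _ _ _) rfl rfl

theorem exists_le_stabilizer_infiniteJoin {G : Type*} [Group G] [TopologicalSpace G]
    (F : SubgroupFamily G) (H : Subgroup G) (hH : H ∈ F) :
    ∃ x : InfiniteJoin (OrbitSum F), H ≤ MulAction.stabilizer G x := by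
  refine ⟨⟨Finsupp.single 0 1, fun n => ?_, ?_, fun _ _ => ⟨⟨H, hH⟩, ((1 : G) : G ⧸ H)⟩⟩,
    fun a ha => InfiniteJoin.ext (fun _ => rfl) fun n _ _ => ?_⟩
  · rw [Finsupp.single_apply]; split_ifs <;> norm_num
  · simp
  · refine congrArg (Sigma.mk (⟨H, hH⟩ : {H : Subgroup G // H ∈ F})) ?_
    change ((a * 1 : G) : G ⧸ H) = _
    rw [mul_one]
    exact (QuotientGroup.eq.2 (by simpa using ha)).symm

/-- The coset `aH` has stabilizer `aHa⁻¹`. -/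
theorem stabilizer_orbitSum_mem {G : Type*} [Group G] [TopologicalSpace G]
    (F : SubgroupFamily G) (z : OrbitSum F) : MulAction.stabilizer G z ∈ F := by
  obtain ⟨H, q⟩ := z
  induction q using QuotientGroup.induction_on with
  | H a =>
  suffices h : MulAction.stabilizer G (⟨H, (a : G ⧸ H.1)⟩ : OrbitSum F) =
      H.1.map (MulAut.conj a).toMonoidHom from h ▸ F.conj_mem H.1 H.2 a
  ext g
  rw [MulAction.mem_stabilizer_iff, Subgroup.mem_map_equiv]
  constructor
  · intro h
    have h := sigma_mk_injective h
    have h : ((g * a : G) : G ⧸ H.1) = a := h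
    have := H.1.inv_mem (QuotientGroup.eq.1 h)
    simpa [mul_assoc] using this
  · intro h
    refine congrArg (Sigma.mk H) ?_
    change ((g * a : G) : G ⧸ H.1) = a
    refine QuotientGroup.eq.2 ?_
    have := H.1.inv_mem h
    simpa [mul_assoc] using this

/-- The stabilizer is the intersection of those of the coordinates of positive weight, of which
there are finitely many and at least one. -/
theorem stabilizer_infiniteJoin_mem {G : Type*} [Group G] [TopologicalSpace G]
    (F : SubgroupFamily G) (x : InfiniteJoin (OrbitSum F)) : MulAction.stabilizer G x ∈ F := by
  have key (S : Finset ℕ) (hS : S.Nonempty) (hx : ∀ n ∈ S, 0 < x.weight n) :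
      ∃ K ∈ F, ∀ g : G, g ∈ K ↔ ∀ n ∈ S, ∀ h : 0 < x.weight n, g • x.coord n h = x.coord n h := by
    induction hS using Finset.Nonempty.cons_induction with
    | singleton n =>
      have hn := hx n (Finset.mem_singleton_self n)
      refine ⟨_, stabilizer_orbitSum_mem F (x.coord n hn), fun g => ?_⟩
      simp [MulAction.mem_stabilizer_iff, hn]
    | cons n S hn hS ih =>
      obtain ⟨K, hK, hgK⟩ := ih fun m hm => hx m (Finset.mem_cons_of_mem hm)
      have hn := hx n (Finset.mem_cons_self n S)
      refine ⟨_, F.inf_mem _ (stabilizer_orbitSum_mem F (x.coord n hn)) _ hK, fun g => ?_⟩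
      simp [Subgroup.mem_inf, MulAction.mem_stabilizer_iff, hn, hgK]
  have hpos (n : ℕ) : n ∈ x.weight.support ↔ 0 < x.weight n := by
    rw [Finsupp.mem_support_iff, (x.weight_nonneg n).lt_iff_ne']
  obtain ⟨n, hn⟩ := x.exists_weight_pos
  obtain ⟨K, hK, hgK⟩ := key x.weight.support ⟨n, (hpos n).2 hn⟩ fun n hn => (hpos n).1 hn
  suffices h : MulAction.stabilizer G x = K from h ▸ hK
  ext g
  rw [hgK, MulAction.mem_stabilizer_iff]
  constructor
  · intro h n _ hn
    have hc (y : InfiniteJoin (OrbitSum F)) (hy : y = x) (hn' : 0 < y.weight n) :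
        y.coord n hn' = x.coord n hn := by subst hy; rfl
    exact hc (g • x) h hn
  · intro h
    exact InfiniteJoin.ext (fun _ => rfl) fun n hn hn' => h n ((hpos n).2 hn') hn'

end EquivariantTopology

theorem mainTheorem5 {G : Type u} [Group G] [TopologicalSpace G] [IsTopologicalGroup G]
    [T2Space G] [LocallyCompactSpace G] (F : SubgroupFamily G) :
    -- existence of a model with isotropy groups in the family
    (∃ (X : Type u) (_ : TopologicalSpace X) (_ : T2Space X) (_ : MulAction G X)
        (_ : ContinuousSMul G X),
      IsClassifyingNumerable.{u, u, v} F X ∧ ∀ x : X, MulAction.stabilizer G x ∈ F) ∧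
    -- the infinite join is such a model
    (IsClassifyingNumerable.{u, u, v} F (InfiniteJoin (OrbitSum F)) ∧
      ∀ x : InfiniteJoin (OrbitSum F), MulAction.stabilizer G x ∈ F) ∧
    -- recognition of models
    (∀ (X : Type w) [TopologicalSpace X] [T2Space X] [MulAction G X] [ContinuousSMul G X],
      IsNumerable F X →
        (IsClassifyingNumerable.{u, w, max u v w} F X ↔
          (∀ H ∈ F, ∃ x : X, H ≤ MulAction.stabilizer G x) ∧
            GHomotopic (GMap.pr₁ G X) (GMap.pr₂ G X))) ∧
    -- contractibility of fixed point sets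
    (∀ (X : Type w) [TopologicalSpace X] [T2Space X] [MulAction G X] [ContinuousSMul G X],
      IsClassifyingNumerable.{u, w, max u v w} F X →
        ∀ H ∈ F, ContractibleSpace (MulAction.fixedPoints H X)) := by
  have hJ : IsClassifyingNumerable.{u, u, v} F (InfiniteJoin (OrbitSum F)) ∧
      ∀ x : InfiniteJoin (OrbitSum F), MulAction.stabilizer G x ∈ F :=
    ⟨isClassifyingNumerable_of_pr F _ (isNumerable_infiniteJoin F)
      (exists_le_stabilizer_infiniteJoin F) (InfiniteJoin.gHomotopic_pr G),
      stabilizer_infiniteJoin_mem F⟩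
  refine ⟨⟨InfiniteJoin (OrbitSum F), inferInstance, inferInstance, inferInstance, inferInstance,
    hJ⟩, hJ, fun X _ _ _ _ hX => ⟨fun h => ?_, fun h => ?_⟩, fun X _ _ _ _ hX H hH => ?_⟩
  · exact ⟨IsClassifyingNumerable.exists_le_stabilizer.{u, v, w} F X h,
      IsClassifyingNumerable.gHomotopic_pr.{u, v, w} F X h⟩
  · exact isClassifyingNumerable_of_pr F X hX h.1 h.2
  · exact contractibleSpace_fixedPoints (IsClassifyingNumerable.gHomotopic_pr.{u, v, w} F X hX) H
      (IsClassifyingNumerable.exists_le_stabilizer.{u, v, w} F X hX H hH)
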